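/- All graphs are finite, undirected, without loops or multiple edges. The orbits of a graph $G$ are the classes of vertices under the action of its automorphism group. If $\mathcal O_1,\dots,\mathcal O_\ell$ is a labeling of the orbits of $G$, then for all $i,j$ the number $s_{i,j}$ of vertices of $\mathcal O_j$ that are adjacent to a vertex $u\in\mathcal O_i$ does not depend on $u$, and $S_G:=[s_{i,j}]\in\mathbb R^{\ell\times\ell}$ is the orbit divisor matrix of $G$ relative to this labeling. Two connected graphs $G$ and $H$ are orbitally similar if they have the same number of orbits and $S_G=S_H$ for suitable labelings of the orbits of $G$ and of $H$. The prism built on $G$ is the Cartesian product $G^\diamond:=G\,\Box\,K_2$, and the $r$-th prism built on $G$ is given by $\diamond^1(G):=G^\diamond$ and $\diamond^{r+1}(G):=[\diamond^r(G)]^\diamond$. Proposition. Let $G$ and $H$ be orbitally similar connected graphs. Then: (a) $G^\diamond$ and $H^\diamond$ are (connected and) orbitally similar. (b) More generally, $\diamond^r(G)$ and $\diamond^r(H)$ are (connected and) orbitally similar for all $r\ge 1$. (c) Let $r\ge 1$ and let $\mathcal O_1,\dots,\mathcal O_\ell$ be any labeling of the orbits of $G$. Then $\diamond^r(G)$ has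 exactly $\ell$ orbits $\mathcal P_1,\dots,\mathcal P_\ell$, where $\mathcal P_i$ is the set of vertices of $\diamond^r(G)$ whose projection to the base $G$ lies in $\mathcal O_i$, and relative to these labelings $S_{\diamond^r(G)}=S_G+rI_\ell$, where $I_\ell$ is the identity matrix of order $\ell$. -/

import Mathlib

universe u v

namespace SimpleGraph

/-- The type of orbits of `G`: the classes of vertices under the action of the group `G ≃g G` of
automorphisms of `G`. The set of vertices that belong to the orbit `o` is `o.orbit`. -/
abbrev Orbit {V : Type u} (G : SimpleGraph V) : Type u :=
  MulAction.orbitRel.Quotient (G ≃g G) V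

/-- Two vertices lie in the same orbit iff some automorphism maps the one to the other. -/
theorem orbit_mk_eq_iff {V : Type u} (G : SimpleGraph V) (a b : V) :
    (Quotient.mk'' a : G.Orbit) = Quotient.mk'' b ↔ ∃ φ : G ≃g G, φ b = a := by
  rw [Quotient.eq'']
  exact Iff.rfl

theorem orbit_apply_mem_iff {V : Type u} (G : SimpleGraph V) (o : G.Orbit) (φ : G ≃g G) (w : V) :
    φ w ∈ o.orbit ↔ w ∈ o.orbit := by
  rw [MulAction.orbitRel.Quotient.mem_orbit, MulAction.orbitRel.Quotient.mem_orbit]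
  have h : (Quotient.mk'' (φ w) : G.Orbit) = Quotient.mk'' w :=
    (G.orbit_mk_eq_iff _ _).2 ⟨φ, rfl⟩
  rw [h]

/-- Orbit partitions are equitable: an automorphism `φ` does not change the number of neighbours
that a vertex has in a given orbit. -/
theorem ncard_adj_orbit_apply {V : Type u} (G : SimpleGraph V) (o : G.Orbit) (φ : G ≃g G)
    (w : V) :
    {x : V | x ∈ o.orbit ∧ G.Adj (φ w) x}.ncard = {x : V | x ∈ o.orbit ∧ G.Adj w x}.ncard := by
  have h : {x : V | x ∈ o.orbit ∧ G.Adj (φ w) x} = φ '' {x : V | x ∈ o.orbit ∧ G.Adj w x} := by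
    ext y
    constructor
    · rintro ⟨hy, ha⟩
      refine ⟨φ.symm y, ⟨?_, ?_⟩, φ.apply_symm_apply y⟩
      · rw [← G.orbit_apply_mem_iff o φ, φ.apply_symm_apply]
        exact hy
      · rw [← φ.map_adj_iff, φ.apply_symm_apply]
        exact ha
    · rintro ⟨x, ⟨hx, ha⟩, rfl⟩
      exact ⟨(G.orbit_apply_mem_iff o φ x).2 hx, φ.map_adj_iff.2 ha⟩
  rw [h, Set.ncard_image_of_injective _ φ.injective]

/-- The number of vertices of the orbit `o'` that are adjacent to a vertex of the orbit `o`; it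
does not depend on the choice of the vertex of `o`. -/
noncomputable def orbitDegree {V : Type u} (G : SimpleGraph V) (o o' : G.Orbit) : ℕ :=
  Quotient.liftOn' o (fun w : V => {x : V | x ∈ o'.orbit ∧ G.Adj w x}.ncard) (by
    intro a b hab
    obtain ⟨φ, rfl⟩ := (G.orbit_mk_eq_iff a b).1 (Quotient.sound' hab)
    exact G.ncard_adj_orbit_apply o' φ b)

/-- The orbit divisor matrix of `G` relative to a labeling `O 0, …, O (ℓ - 1)` of its orbits: the
`(i, j)` entry is the number of vertices of `O j` adjacent to any given vertex of `O i`. -/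
noncomputable def orbitDivisorMatrix {V : Type u} (G : SimpleGraph V) {ℓ : ℕ}
    (O : Fin ℓ ≃ G.Orbit) : Matrix (Fin ℓ) (Fin ℓ) ℝ :=
  Matrix.of fun i j => (G.orbitDegree (O i) (O j) : ℝ)

theorem orbitDivisorMatrix_apply {V : Type u} (G : SimpleGraph V) {ℓ : ℕ}
    (O : Fin ℓ ≃ G.Orbit) (i j : Fin ℓ) (w : V) (hw : w ∈ (O i).orbit) :
    G.orbitDivisorMatrix O i j = ({x : V | x ∈ (O j).orbit ∧ G.Adj w x}.ncard : ℝ) := by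
  rw [MulAction.orbitRel.Quotient.mem_orbit] at hw
  simp only [orbitDivisorMatrix, Matrix.of_apply, ← hw]
  rfl

/-- `G` and `H` are connected, have the same number `ℓ` of orbits, and the orbits can be labeled in
such a way that the orbit divisor matrices of `G` and `H` are equal. -/
def OrbitallySimilar {V : Type u} {W : Type v} (G : SimpleGraph V) (H : SimpleGraph W) : Prop :=
  G.Connected ∧ H.Connected ∧
    ∃ (ℓ : ℕ) (O : Fin ℓ ≃ G.Orbit) (Q : Fin ℓ ≃ H.Orbit),
      G.orbitDivisorMatrix O = H.orbitDivisorMatrix Q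

/-- The prism `G □ K₂`. -/
def prism {V : Type u} (G : SimpleGraph V) : SimpleGraph (V × Fin 2) :=
  G □ completeGraph (Fin 2)

/-- The vertices of the `r`-th prism built on a graph with vertex type `V`. -/
def IterPrismVertex (V : Type u) : ℕ → Type u
  | 0 => V
  | r + 1 => IterPrismVertex V r × Fin 2

/-- The `r`-th prism built on `G`: the prism construction iterated `r` times. -/
def iterPrism {V : Type u} (G : SimpleGraph V) : (r : ℕ) → SimpleGraph (IterPrismVertex V r)
  | 0 => G
  | r + 1 => (iterPrism G r).prism

theorem iterPrism_one {V : Type u} (G : SimpleGraph V) : G.iterPrism 1 = G.prism := rfl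

/-- The projection of the `r`-th prism onto its base: it forgets the `r` coordinates in `K₂`. -/
def iterPrismBase {V : Type u} : (r : ℕ) → IterPrismVertex V r → V
  | 0, x => x
  | r + 1, x => iterPrismBase r x.1

end SimpleGraph

namespace SimpleGraph

/-! Everything reduces to one claim: if `G` is connected and `φ` is an automorphism of the prism
with `φ (u, i) = (v, i)`, then some automorphism of `G` maps `u` to `v`. Let `τ` exchange the two
copies of `G` and put `τ' = φ τ φ⁻¹`. Both are flips, and by connectedness they agree everywhere or
nowhere (`apply_eq_of_connected`). If everywhere, `φ` commutes with `τ` and descends to `G`. If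
nowhere, they are two independent `K₂` coordinates; the automorphism `swap` exchanging them
conjugates `τ'` to `τ` and fixes `(v, i)`, so `φ` followed by `swap` descends. Hence orbits of the
prism are preimages of orbits of `G`. The one extra neighbour of a vertex, its twin, lies in its own
orbit and adds the identity to the divisor matrix. Induction on `r` does the rest. -/

theorem rev_ne_self_two (i : Fin 2) : i.rev ≠ i := by
  revert i
  decide

theorem eq_rev_of_ne_two {i j : Fin 2} (h : j ≠ i) : j = i.rev := by
  revert i j
  decide

/-- An automorphism `τ` and a two-colouring `c` of the vertices such that the edges that join
different colours are exactly the edges between `p` and `τ p`. -/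
structure IsFlip {P : Type u} (K : SimpleGraph P) (τ : K ≃g K) (c : P → Fin 2) : Prop where
  adj_apply : ∀ p, K.Adj p (τ p)
  apply_apply : ∀ p, τ (τ p) = p
  side_apply : ∀ p, c (τ p) ≠ c p
  eq_apply : ∀ {p q}, K.Adj p q → c q ≠ c p → q = τ p

/-! ### Pairs of flips on one graph -/

namespace IsFlip

variable {P : Type u} {K : SimpleGraph P} {τ τ' : K ≃g K} {c c' : P → Fin 2}

theorem conj (h : K.IsFlip τ c) (φ : K ≃g K) :
    K.IsFlip ((φ.symm.trans τ).trans φ) (fun p => c (φ.symm p)) where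
  adj_apply p := by
    have := φ.map_adj_iff.2 (h.adj_apply (φ.symm p))
    simpa using this
  apply_apply p := by simp [h.apply_apply]
  side_apply p := by simpa using h.side_apply (φ.symm p)
  eq_apply {p q} ha hc := by
    have := h.eq_apply (φ.symm.map_adj_iff.2 ha) hc
    simpa using congrArg φ this

/-- Suppose `q ≠ τ p`. Then `p` and `q` have the same `c'`-colour. If `τ q` had it too, the edge
from `τ p = τ' p` to `τ q` would cross `c'`, forcing `τ q = p`, that is `q = τ p`. So the edge from
`q` to `τ q` crosses `c'`. -/
theorem apply_eq_of_adj (h : K.IsFlip τ c) (h' : K.IsFlip τ' c') {p q : P} (hp : τ p = τ' p)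
    (ha : K.Adj p q) : τ q = τ' q := by
  by_cases hq : q = τ p
  · rw [hq, h.apply_apply, hp, h'.apply_apply]
  have hqc : c' q = c' p := by
    by_contra hc
    exact hq (hp ▸ h'.eq_apply ha hc)
  apply h'.eq_apply (h.adj_apply q)
  intro hc
  have hadj : K.Adj (τ' p) (τ q) := hp ▸ τ.map_adj_iff.2 ha
  have hne : c' (τ q) ≠ c' (τ' p) := by
    rw [hc, hqc]
    exact (h'.side_apply p).symm
  have := h'.eq_apply hadj hne
  rw [h'.apply_apply] at this
  exact hq (by rw [← this, h.apply_apply])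

/-- In a connected graph two flips agree everywhere or nowhere. -/
theorem apply_eq_of_connected (h : K.IsFlip τ c) (h' : K.IsFlip τ' c') (hK : K.Connected)
    {p : P} (hp : τ p = τ' p) (q : P) : τ q = τ' q := by
  obtain ⟨w⟩ := hK.preconnected p q
  induction w with
  | nil => exact hp
  | cons ha _ ih => exact ih (h.apply_eq_of_adj h' hp ha)

theorem side_apply_of_ne (h : K.IsFlip τ c) (h' : K.IsFlip τ' c') (hne : ∀ p, τ p ≠ τ' p)
    (p : P) : c (τ' p) = c p := by
  by_contra hc
  exact hne p (h.eq_apply (h'.adj_apply p) hc).symm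

theorem apply_comm_of_ne (h : K.IsFlip τ c) (h' : K.IsFlip τ' c') (hne : ∀ p, τ p ≠ τ' p)
    (p : P) : τ (τ' p) = τ' (τ p) := by
  apply h'.eq_apply (τ.map_adj_iff.2 (h'.adj_apply p))
  rw [h'.side_apply_of_ne h (fun q => (hne q).symm), h'.side_apply_of_ne h fun q => (hne q).symm]
  exact h'.side_apply p

/-- The map that exchanges the two coordinates `c` and `c'`. -/
def swapFun (τ τ' : K ≃g K) (c c' : P → Fin 2) (p : P) : P :=
  if c p = c' p then p else τ (τ' p)

theorem swapFun_swapFun (h : K.IsFlip τ c) (h' : K.IsFlip τ' c') (hne : ∀ p, τ p ≠ τ' p)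
    (p : P) : swapFun τ τ' c c' (swapFun τ τ' c c' p) = p := by
  have hne' : ∀ q, τ' q ≠ τ q := fun q => (hne q).symm
  unfold swapFun
  split_ifs with h1 h2
  · rfl
  -- `τ ∘ τ'` changes both colours, so unequal colours stay unequal.
  · exfalso
    have e1 := h.side_apply (τ' p)
    have e2 := h'.side_apply p
    rw [h.side_apply_of_ne h' hne] at e1
    rw [h'.side_apply_of_ne h hne'] at h2
    rw [h2] at e1
    exact h1 (by omega)
  · rw [← h.apply_comm_of_ne h' hne, h.apply_apply, h'.apply_apply]

/-- This intertwining makes `φ` followed by the swap commute with `τ` when `τ' = φ τ φ⁻¹`. -/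
theorem swapFun_apply (h : K.IsFlip τ c) (h' : K.IsFlip τ' c') (hne : ∀ p, τ p ≠ τ' p)
    (p : P) : swapFun τ τ' c c' (τ' p) = τ (swapFun τ τ' c c' p) := by
  have e1 := h.side_apply_of_ne h' hne p
  have e2 := h'.side_apply p
  unfold swapFun
  rw [e1]
  split_ifs with h1 h2 h2
  · omega
  · rw [h.apply_apply]
  · rw [h'.apply_apply]
  · omega

/-- On an edge that crosses neither colouring, both ends are moved by the same automorphism, the
identity or `τ ∘ τ'`. The remaining edges are `τ`-edges and `τ'`-edges, which are interchanged. -/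
theorem swapFun_adj (h : K.IsFlip τ c) (h' : K.IsFlip τ' c') (hne : ∀ p, τ p ≠ τ' p)
    {p q : P} (ha : K.Adj p q) : K.Adj (swapFun τ τ' c c' p) (swapFun τ τ' c c' q) := by
  have hne' : ∀ q, τ' q ≠ τ q := fun q => (hne q).symm
  by_cases hc' : c' q = c' p
  · by_cases hc : c q = c p
    · unfold swapFun
      rw [hc, hc']
      split_ifs
      · exact ha
      · exact τ.map_adj_iff.2 (τ'.map_adj_iff.2 ha)
    · obtain rfl := h.eq_apply ha hc
      have : swapFun τ τ' c c' (τ p) = τ' (swapFun τ τ' c c' p) := by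
        rw [← h.swapFun_swapFun h' hne (τ' _), h.swapFun_apply h' hne, h.swapFun_swapFun h' hne]
      rw [this]
      exact h'.adj_apply _
  · obtain rfl := h'.eq_apply ha hc'
    rw [h.swapFun_apply h' hne]
    exact h.adj_apply _

/-- The automorphism that exchanges the coordinates of two flips that never agree. -/
def swap (h : K.IsFlip τ c) (h' : K.IsFlip τ' c') (hne : ∀ p, τ p ≠ τ' p) : K ≃g K where
  toFun := swapFun τ τ' c c'
  invFun := swapFun τ τ' c c'
  left_inv := h.swapFun_swapFun h' hne
  right_inv := h.swapFun_swapFun h' hne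
  map_rel_iff' {p q} := by
    refine ⟨fun ha => ?_, h.swapFun_adj h' hne⟩
    have := h.swapFun_adj h' hne ha
    simpa only [Equiv.coe_fn_mk, h.swapFun_swapFun h' hne] using this

theorem swap_apply (h : K.IsFlip τ c) (h' : K.IsFlip τ' c') (hne : ∀ p, τ p ≠ τ' p) (p : P) :
    h.swap h' hne p = swapFun τ τ' c c' p := rfl

end IsFlip

/-! ### Descent of automorphisms from the prism to its base -/

variable {V : Type u} (G : SimpleGraph V)

theorem prism_adj {p q : V × Fin 2} :
    G.prism.Adj p q ↔ G.Adj p.1 q.1 ∧ p.2 = q.2 ∨ p.2 ≠ q.2 ∧ p.1 = q.1 := by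
  simp [prism, boxProd_adj]

/-- The automorphism of the prism that exchanges the two copies of `G`. -/
def prismFlip : G.prism ≃g G.prism where
  toEquiv := (Equiv.refl V).prodCongr Fin.revPerm
  map_rel_iff' := by simp [prism_adj]

@[simp]
theorem prismFlip_apply (u : V) (i : Fin 2) : G.prismFlip (u, i) = (u, i.rev) := rfl

theorem isFlip_prismFlip : G.prism.IsFlip G.prismFlip Prod.snd where
  adj_apply := by
    rintro ⟨u, i⟩
    simp only [prism_adj, prismFlip_apply]
    exact Or.inr ⟨(rev_ne_self_two i).symm, trivial⟩
  apply_apply := by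
    rintro ⟨u, i⟩
    simp
  side_apply := by
    rintro ⟨u, i⟩
    exact rev_ne_self_two i
  eq_apply := by
    rintro ⟨u, i⟩ ⟨v, j⟩ ha hc
    simp only [prism_adj, prismFlip_apply, Prod.mk.injEq] at *
    rcases ha with ha | ha
    · exact absurd ha.2.symm hc
    · exact ⟨ha.2.symm, eq_rev_of_ne_two hc⟩

variable {G}

/-- The map of the base induced by an automorphism of the prism. -/
theorem exists_iso_of_comm_prismFlip (ψ : G.prism ≃g G.prism)
    (hψ : ∀ p, ψ (G.prismFlip p) = G.prismFlip (ψ p)) :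
    ∃ α : G ≃g G, ∀ u i, α u = (ψ (u, i)).1 := by
  have key : ∀ χ : G.prism ≃g G.prism, (∀ p, χ (G.prismFlip p) = G.prismFlip (χ p)) →
      (∀ u i j, (χ (u, i)).1 = (χ (u, j)).1) ∧
      ∀ u v, G.Adj u v → G.Adj (χ (u, 0)).1 (χ (v, 0)).1 := by
    intro χ hχ
    have h1 : ∀ u i j, (χ (u, i)).1 = (χ (u, j)).1 := by
      intro u i j
      by_cases hij : j = i
      · rw [hij]
      · have : ((u, j) : V × Fin 2) = G.prismFlip (u, i) := by
          rw [prismFlip_apply, ← eq_rev_of_ne_two hij]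
        rw [this, hχ]
        rfl
    refine ⟨h1, fun u v huv => ?_⟩
    have ha : G.prism.Adj (χ (u, 0)) (χ (v, 0)) :=
      χ.map_adj_iff.2 (G.prism_adj.2 (Or.inl ⟨huv, rfl⟩))
    rcases G.prism_adj.1 ha with h | h
    · exact h.1
    -- An image edge between the copies would be a flip edge; pulled back through `χ`, it would give
    -- `v = u`.
    · have := G.isFlip_prismFlip.eq_apply ha h.1.symm
      rw [← hχ] at this
      exact absurd (congrArg Prod.fst (χ.injective this)).symm huv.ne
  have hs : ∀ p, ψ.symm (G.prismFlip p) = G.prismFlip (ψ.symm p) := by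
    intro p
    apply ψ.injective
    rw [hψ]
    simp
  obtain ⟨h1, h2⟩ := key ψ hψ
  obtain ⟨k1, k2⟩ := key ψ.symm hs
  have left : ∀ u, (ψ.symm ((ψ (u, 0)).1, 0)).1 = u := by
    intro u
    rw [k1 _ 0 (ψ (u, 0)).2]
    simp
  have right : ∀ u, (ψ ((ψ.symm (u, 0)).1, 0)).1 = u := by
    intro u
    rw [h1 _ 0 (ψ.symm (u, 0)).2]
    simp
  refine ⟨⟨⟨fun u => (ψ (u, 0)).1, fun u => (ψ.symm (u, 0)).1, left, right⟩, ?_⟩,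
    fun u i => h1 u 0 i⟩
  intro u v
  refine ⟨fun ha => ?_, h2 u v⟩
  have := k2 _ _ ha
  simpa only [Equiv.coe_fn_mk, left] using this

theorem exists_iso_of_prism_iso (hP : G.prism.Connected)
    (φ : G.prism ≃g G.prism) {u v : V} {i : Fin 2} (h : φ (u, i) = (v, i)) :
    ∃ α : G ≃g G, α u = v := by
  have h0 := G.isFlip_prismFlip
  have h1 := h0.conj φ
  by_cases hne : ∀ p, G.prismFlip p ≠ (φ.symm.trans G.prismFlip).trans φ p
  · obtain ⟨α, hα⟩ := exists_iso_of_comm_prismFlip (φ.trans (h0.swap h1 hne)) (by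
      intro p
      have := h0.swapFun_apply h1 hne (φ p)
      simpa [IsFlip.swap_apply] using this)
    refine ⟨α, ?_⟩
    rw [hα u i]
    -- Both colours of `(v, i) = φ (u, i)` equal `i`, so the swap fixes it.
    rw [RelIso.trans_apply, IsFlip.swap_apply, IsFlip.swapFun, if_pos (by rw [RelIso.symm_apply_apply, h]), h]
  · push Not at hne
    obtain ⟨p, hp⟩ := hne
    obtain ⟨α, hα⟩ := exists_iso_of_comm_prismFlip φ (by
      intro q
      have := h0.apply_eq_of_connected h1 hP hp (φ q)
      simpa using this.symm)
    exact ⟨α, by rw [hα u i, h]⟩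

theorem Connected.prism (hG : G.Connected) : G.prism.Connected :=
  hG.boxProd connected_top

/-- Automorphisms of the base act on the prism. -/
def Iso.prism (α : G ≃g G) : G.prism ≃g G.prism where
  toEquiv := α.toEquiv.prodCongr (Equiv.refl _)
  map_rel_iff' := by
    intro p q
    simp [prism_adj, α.map_adj_iff]

/-! ### Orbits and divisor matrices of prisms -/

theorem prism_orbit_mk_eq_iff (hG : G.Connected) (p q : V × Fin 2) :
    (Quotient.mk'' p : G.prism.Orbit) = Quotient.mk'' q ↔
      (Quotient.mk'' p.1 : G.Orbit) = Quotient.mk'' q.1 := by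
  obtain ⟨u, i⟩ := p
  obtain ⟨v, j⟩ := q
  rw [orbit_mk_eq_iff, orbit_mk_eq_iff]
  constructor
  · rintro ⟨φ, hφ⟩
    by_cases hij : i = j
    · subst hij
      exact exists_iso_of_prism_iso hG.prism φ hφ
    -- Composing with the flip brings the image back to the copy it started from.
    · refine exists_iso_of_prism_iso hG.prism (φ.trans G.prismFlip) (i := j) ?_
      change G.prismFlip (φ (v, j)) = (u, j)
      rw [hφ, prismFlip_apply, ← eq_rev_of_ne_two (Ne.symm hij)]
  · rintro ⟨α, hα⟩
    by_cases hij : i = j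
    · subst hij
      exact ⟨α.prism, Prod.ext hα rfl⟩
    · exact ⟨α.prism.trans G.prismFlip, Prod.ext hα (eq_rev_of_ne_two hij).symm⟩

/-- The orbits of the prism on a connected graph correspond to the orbits of its base. -/
noncomputable def prismOrbitEquiv (hG : G.Connected) : G.prism.Orbit ≃ G.Orbit :=
  Equiv.ofBijective
    (fun o => Quotient.liftOn' o (fun p : V × Fin 2 => (Quotient.mk'' p.1 : G.Orbit))
      fun p q h => (prism_orbit_mk_eq_iff hG p q).1 (Quotient.sound' h)) (by
    constructor
    · intro o o'
      induction o using Quotient.inductionOn'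
      induction o' using Quotient.inductionOn'
      exact (prism_orbit_mk_eq_iff hG _ _).2
    · intro o
      induction o using Quotient.inductionOn' with
      | h u => exact ⟨Quotient.mk'' (u, 0), rfl⟩)

theorem mem_orbit_prismOrbitEquiv_symm (hG : G.Connected) (o : G.Orbit) (p : V × Fin 2) :
    p ∈ ((prismOrbitEquiv hG).symm o).orbit ↔ p.1 ∈ o.orbit := by
  rw [MulAction.orbitRel.Quotient.mem_orbit, MulAction.orbitRel.Quotient.mem_orbit,
    Equiv.eq_symm_apply]
  rfl

theorem orbitDivisorMatrix_prism [Finite V] (hG : G.Connected) {ℓ : ℕ} (O : Fin ℓ ≃ G.Orbit) :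
    G.prism.orbitDivisorMatrix (O.trans (prismOrbitEquiv hG).symm) =
      G.orbitDivisorMatrix O + 1 := by
  ext i j
  obtain ⟨w, hw⟩ := Quotient.exists_rep (O i)
  replace hw : w ∈ (O i).orbit := MulAction.orbitRel.Quotient.mem_orbit.2 hw
  have hw' : ((w, 0) : V × Fin 2) ∈ ((O.trans (prismOrbitEquiv hG).symm) i).orbit :=
    (mem_orbit_prismOrbitEquiv_symm hG _ _).2 hw
  rw [Matrix.add_apply, G.prism.orbitDivisorMatrix_apply _ i j _ hw',
    G.orbitDivisorMatrix_apply O i j w hw, Matrix.one_apply]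
  set S : Set V := {x | x ∈ (O j).orbit ∧ G.Adj w x} with hS
  have hmem : w ∈ (O j).orbit ↔ i = j := by
    rw [MulAction.orbitRel.Quotient.mem_orbit] at hw ⊢
    rw [hw, O.injective.eq_iff]
  have himg : ((fun x : V => (x, (0 : Fin 2))) '' S).ncard = S.ncard :=
    Set.ncard_image_of_injective _ (Prod.mk_left_injective 0)
  by_cases hij : i = j
  · have hset : {x : V × Fin 2 | x ∈ ((O.trans (prismOrbitEquiv hG).symm) j).orbit ∧
        G.prism.Adj (w, 0) x} = insert (w, 1) ((fun x : V => (x, (0 : Fin 2))) '' S) := by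
      ext ⟨x, k⟩
      have hm := mem_orbit_prismOrbitEquiv_symm hG (O j) (x, k)
      simp only [Set.mem_ofPred_eq, Equiv.trans_apply, hm, prism_adj, Set.mem_insert_iff,
        Set.mem_image, hS, Prod.mk.injEq]
      constructor
      · rintro ⟨hx, ⟨ha, rfl⟩ | ⟨hk, rfl⟩⟩
        · exact Or.inr ⟨x, ⟨hx, ha⟩, rfl, rfl⟩
        · exact Or.inl ⟨rfl, by omega⟩
      · rintro (⟨rfl, rfl⟩ | ⟨y, ⟨hy, ha⟩, rfl, rfl⟩)
        · exact ⟨hmem.2 hij, Or.inr ⟨by decide, rfl⟩⟩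
        · exact ⟨hy, Or.inl ⟨ha, rfl⟩⟩
    -- Finiteness matters: `ncard` is `0` on infinite sets, so the twin would not add one.
    rw [hset, Set.ncard_insert_of_notMem (by simp) (Set.toFinite _), himg, if_pos hij]
    push_cast
    rfl
  · have hset : {x : V × Fin 2 | x ∈ ((O.trans (prismOrbitEquiv hG).symm) j).orbit ∧
        G.prism.Adj (w, 0) x} = (fun x : V => (x, (0 : Fin 2))) '' S := by
      ext ⟨x, k⟩
      have hm := mem_orbit_prismOrbitEquiv_symm hG (O j) (x, k)
      simp only [Set.mem_ofPred_eq, Equiv.trans_apply, hm, prism_adj,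
        Set.mem_image, hS, Prod.mk.injEq]
      constructor
      · rintro ⟨hx, ⟨ha, rfl⟩ | ⟨hk, rfl⟩⟩
        · exact ⟨x, ⟨hx, ha⟩, rfl, rfl⟩
        · exact absurd (hmem.1 hx) hij
      · rintro ⟨y, ⟨hy, ha⟩, rfl, rfl⟩
        exact ⟨hy, Or.inl ⟨ha, rfl⟩⟩
    rw [hset, himg, if_neg hij, add_zero]

theorem finite_iterPrismVertex (V : Type u) [Finite V] : ∀ r, Finite (IterPrismVertex V r)
  | 0 => ‹Finite V›
  | r + 1 =>
    have := finite_iterPrismVertex V r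
    inferInstanceAs (Finite (IterPrismVertex V r × Fin 2))

theorem Connected.iterPrism (hG : G.Connected) : ∀ r, (G.iterPrism r).Connected
  | 0 => hG
  | r + 1 => (Connected.iterPrism hG r).prism

theorem exists_orbit_labeling_iterPrism [Finite V] (hG : G.Connected) (r : ℕ) {ℓ : ℕ}
    (O : Fin ℓ ≃ G.Orbit) :
    ∃ P : Fin ℓ ≃ (G.iterPrism r).Orbit,
      (∀ i : Fin ℓ, (P i).orbit = iterPrismBase r ⁻¹' (O i).orbit) ∧
      (G.iterPrism r).orbitDivisorMatrix P =
        G.orbitDivisorMatrix O + (r : ℝ) • (1 : Matrix (Fin ℓ) (Fin ℓ) ℝ) := by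
  induction r with
  | zero => exact ⟨O, fun _ => rfl, by
      rw [Nat.cast_zero, zero_smul, add_zero]
      rfl⟩
  | succ r ih =>
    obtain ⟨P, hP, hM⟩ := ih
    have := finite_iterPrismVertex V r
    refine ⟨P.trans (prismOrbitEquiv (hG.iterPrism r)).symm, fun i => ?_, ?_⟩
    · ext p
      exact (mem_orbit_prismOrbitEquiv_symm (hG.iterPrism r) (P i) p).trans
        (Set.ext_iff.1 (hP i) p.1)
    · refine (orbitDivisorMatrix_prism (hG.iterPrism r) P).trans ?_
      rw [hM, add_assoc, Nat.cast_succ, add_smul, one_smul]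

theorem OrbitallySimilar.iterPrism [Finite V] {W : Type v} [Finite W] {H : SimpleGraph W}
    (h : G.OrbitallySimilar H) (r : ℕ) : (G.iterPrism r).OrbitallySimilar (H.iterPrism r) := by
  obtain ⟨hG, hH, ℓ, O, Q, hOQ⟩ := h
  obtain ⟨P, -, hP⟩ := exists_orbit_labeling_iterPrism hG r O
  obtain ⟨R, -, hR⟩ := exists_orbit_labeling_iterPrism hH r Q
  exact ⟨hG.iterPrism r, hH.iterPrism r, ℓ, P, R, by rw [hP, hR, hOQ]⟩

end SimpleGraph

theorem mainTheorem6 {V : Type u} {W : Type v} [Finite V] [Finite W]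
    (G : SimpleGraph V) (H : SimpleGraph W) (hGH : G.OrbitallySimilar H) :
    G.prism.OrbitallySimilar H.prism ∧
    (∀ r : ℕ, 1 ≤ r → (G.iterPrism r).OrbitallySimilar (H.iterPrism r)) ∧
    (∀ r : ℕ, 1 ≤ r → ∀ (ℓ : ℕ) (O : Fin ℓ ≃ G.Orbit),
      ∃ P : Fin ℓ ≃ (G.iterPrism r).Orbit,
        (∀ i : Fin ℓ, (P i).orbit = SimpleGraph.iterPrismBase r ⁻¹' (O i).orbit) ∧
        (G.iterPrism r).orbitDivisorMatrix P =
          G.orbitDivisorMatrix O + (r : ℝ) • (1 : Matrix (Fin ℓ) (Fin ℓ) ℝ)) := by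
  exact ⟨hGH.iterPrism 1, fun r _ => hGH.iterPrism r,
    fun r _ _ O => SimpleGraph.exists_orbit_labeling_iterPrism hGH.1 r O⟩
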